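/- All rings are commutative with $1$, and a local ring is by definition Noetherian. Let $(T,M)$ be a local ring that is complete (and separated) with respect to its maximal ideal $M$, and suppose that $\dim T \ge 2$. Then the following are equivalent: (a) there is a local integral domain $(A,\mathfrak m)$ whose prime spectrum $\operatorname{Spec}(A)$ is countable and whose $\mathfrak m$-adic completion $\widehat A=\varprojlim_n A/\mathfrak m^n$ is isomorphic to $T$ as a ring; (b) the following three conditions hold: (i) no integer of $T$ is a zerodivisor, that is, for every $n\in\mathbb Z$ such that $n\cdot 1_T\neq 0$, the element $n\cdot 1_T$ is not a zerodivisor of $T$; (ii) $M\notin\operatorname{Ass}(T)$, that is, $M$ is not the annihilator of an element of $T$; (iii) the residue field $T/M$ is countable. Here "countable" means finite or countably infinite. -/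

import Mathlib

universe u

open IsLocalRing

/-! Nonzero elements of a domain `A` stay regular in its flat completion. This gives (i), and also
(ii), since the maximal ideal is nonzero. If the residue field were uncountable, countable prime
avoidance would give an `x` in the maximal ideal lying in no other prime. The maximal ideal of the
completion would then be minimal over `x`, and Krull's height theorem would contradict dimension at
least 2.

Conversely, `A` is built as a countable subring of `T` with nonzero elements regular in `T`, with
`IT ∩ A = I` for finitely generated `I`, and meeting modulo `M ^ 2` a set of residue representatives
and a set of generators of `M`. Such an `A` is Noetherian with completion `T`, and its primes, being
finitely generated, are countably many. The subring grows by elements `t + b * y` with `b` regular,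
where a Baire argument picks `y` making `t + b * y` transcendental over it modulo every associated
prime. -/

/-! ### Necessity of the conditions. -/

/-- Countable prime avoidance: over a local ring with uncountable residue field, a finitely
generated ideal covered by countably many ideals lies in one of them. -/
theorem IsLocalRing.exists_ideal_le_of_subset_iUnion {A ι : Type*} [CommRing A] [IsLocalRing A]
    [Uncountable (ResidueField A)] [Countable ι] {I : Ideal A} (hI : I.FG) (P : ι → Ideal A)
    (h : (I : Set A) ⊆ ⋃ i, (P i : Set A)) : ∃ i, I ≤ P i := by
  obtain ⟨n, x, rfl⟩ := Submodule.fg_iff_exists_fin_generating_family.mp hI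
  let σ : ResidueField A → A := Function.surjInv residue_surjective
  have hσ : ∀ u, residue A (σ u) = u := Function.surjInv_eq residue_surjective
  -- Uncountably many combinations fall into countably many ideals, so some `P i` receives
  -- infinitely many. Any `n` of these recover all `x j`: their Vandermonde matrix has distinct
  -- nodes in the residue field, hence unit determinant.
  have hmem : ∀ u : ResidueField A, ∃ i, ∑ j : Fin n, σ u ^ (j : ℕ) * x j ∈ P i := fun u ↦ by
    have : ∑ j : Fin n, σ u ^ (j : ℕ) * x j ∈ Submodule.span A (Set.range x) :=
      Submodule.sum_mem _ fun j _ ↦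
        Submodule.smul_mem _ (σ u ^ (j : ℕ)) (Submodule.subset_span (Set.mem_range_self j))
    simpa using h this
  choose c hc using hmem
  obtain ⟨i, hi⟩ : ∃ i, (c ⁻¹' {i}).Infinite := by
    by_contra! hfin
    have : (⋃ i, c ⁻¹' {i}).Countable :=
      Set.countable_iUnion fun i ↦ (hfin i).countable
    rw [← Set.preimage_iUnion, Set.iUnion_of_singleton, Set.preimage_univ,
      Set.countable_univ_iff] at this
    exact not_countable this
  refine ⟨i, ?_⟩
  let u : Fin n → ResidueField A := fun j ↦ hi.natEmbedding _ j
  have hu : Function.Injective u := fun a b hab ↦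
    Fin.ext ((hi.natEmbedding _).injective (Subtype.ext hab))
  let V : Matrix (Fin n) (Fin n) A := Matrix.vandermonde (fun j ↦ σ (u j))
  have hV : IsUnit V.det := by
    rw [← residue_ne_zero_iff_isUnit, RingHom.map_det, RingHom.mapMatrix_apply]
    have : V.map (residue A) = Matrix.vandermonde u := by
      ext a b
      simp [V, Matrix.vandermonde_apply, hσ]
    rw [this, Matrix.det_vandermonde_ne_zero_iff]
    exact hu
  have hy : ∀ j, (V.mulVec x) j ∈ P i := fun j ↦ by
    have h1 : c (u j) = i := (hi.natEmbedding _ (j : ℕ)).2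
    have h2 := hc (u j)
    rw [h1] at h2
    simpa [V, Matrix.mulVec, dotProduct, Matrix.vandermonde_apply] using h2
  rw [Submodule.span_le]
  rintro _ ⟨j, rfl⟩
  have h3 : V⁻¹.mulVec (V.mulVec x) = x := by
    rw [Matrix.mulVec_mulVec, Matrix.nonsing_inv_mul _ hV, Matrix.one_mulVec]
  rw [← h3]
  have h4 : ∑ k, V⁻¹ j k * V.mulVec x k ∈ P i :=
    (P i).sum_mem fun k _ ↦ (P i).mul_mem_left (V⁻¹ j k) (hy k)
  exact h4

/-- A local ring with Noetherian completion of dimension at least two and countable spectrum has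
countable residue field. -/
theorem IsLocalRing.countable_residueField_of_countable_primeSpectrum {A : Type u} [CommRing A]
    [IsLocalRing A] [IsNoetherianRing A] [IsNoetherianRing (AdicCompletion (maximalIdeal A) A)]
    (hdim : 2 ≤ ringKrullDim (AdicCompletion (maximalIdeal A) A)) [Countable (PrimeSpectrum A)] :
    Countable (ResidueField A) := by
  by_contra hk
  rw [not_countable_iff] at hk
  obtain ⟨x, hxm, hx⟩ : ∃ x ∈ maximalIdeal A, ∀ q : Ideal A, q.IsPrime → x ∈ q →
      q = maximalIdeal A := by
    by_contra! hcon
    obtain ⟨⟨p, hp⟩, hle⟩ := exists_ideal_le_of_subset_iUnion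
      (maximalIdeal A).fg_of_isNoetherianRing
      (fun p : {p : PrimeSpectrum A // p.asIdeal ≠ maximalIdeal A} ↦ p.1.asIdeal) (fun x hx ↦ by
        obtain ⟨q, hq, hxq, hne⟩ := hcon x hx
        exact Set.mem_iUnion.mpr ⟨⟨⟨q, hq⟩, hne⟩, hxq⟩)
    exact hp ((le_maximalIdeal p.2.ne_top).antisymm hle)
  let φ := algebraMap A (AdicCompletion (maximalIdeal A) A)
  have hmin : maximalIdeal (AdicCompletion (maximalIdeal A) A) ∈
      (Ideal.span {φ x}).minimalPrimes := by
    refine ⟨⟨inferInstance, ?_⟩, fun q ⟨hq, hxq⟩ _ ↦ ?_⟩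
    · rw [Ideal.span_singleton_le_iff_mem, AdicCompletion.maximalIdeal_eq_map]
      exact Ideal.mem_map_of_mem _ hxm
    · rw [AdicCompletion.maximalIdeal_eq_map, Ideal.map_le_iff_le_comap]
      rw [Ideal.span_singleton_le_iff_mem] at hxq
      exact (hx (q.comap φ) (hq.comap φ) hxq).ge
  have h1 := Ideal.height_le_one_of_isPrincipal_of_mem_minimalPrimes _ _ hmin
  rw [← maximalIdeal_height_eq_ringKrullDim] at hdim
  have h2 : ((2 : ℕ∞) : WithBot ℕ∞) ≤ ((1 : ℕ∞) : WithBot ℕ∞) :=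
    le_trans hdim (WithBot.coe_le_coe.mpr h1)
  norm_num [WithBot.coe_le_coe] at h2

theorem AdicCompletion.algebraMap_mem_nonZeroDivisors {A : Type u} [CommRing A]
    [IsNoetherianRing A] (I : Ideal A) {x : A} (hx : x ∈ nonZeroDivisors A) :
    algebraMap A (AdicCompletion I A) x ∈ nonZeroDivisors (AdicCompletion I A) := by
  rw [mem_nonZeroDivisors_iff_right]
  intro y hy
  refine (Module.Flat.isSMulRegular_of_nonZeroDivisors (M := AdicCompletion I A) hx)
    (?_ : x • y = x • 0)
  rw [smul_zero, Algebra.smul_def, mul_comm, hy]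

/-- Necessary conditions for a ring to be the completion of a local domain with countable
spectrum. -/
theorem necessary_of_completion_equiv {T : Type u} [CommRing T] [IsLocalRing T]
    [IsNoetherianRing T] (hdim : 2 ≤ ringKrullDim T) {A : Type u} [CommRing A] [IsDomain A]
    [IsLocalRing A] [IsNoetherianRing A] [Countable (PrimeSpectrum A)]
    (e : AdicCompletion (maximalIdeal A) A ≃+* T) :
    (∀ n : ℤ, (n : T) ≠ 0 → (n : T) ∈ nonZeroDivisors T) ∧
      maximalIdeal T ∉ associatedPrimes T T ∧ Countable (T ⧸ maximalIdeal T) := by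
  have : IsNoetherianRing (AdicCompletion (maximalIdeal A) A) :=
    isNoetherianRing_of_ringEquiv T e.symm
  rw [← ringKrullDim_eq_of_ringEquiv e] at hdim
  let φ : A →+* T := e.toRingHom.comp (algebraMap A (AdicCompletion (maximalIdeal A) A))
  have hφ : ∀ x : A, x ≠ 0 → φ x ∈ nonZeroDivisors T := fun x hx ↦ by
    have := AdicCompletion.algebraMap_mem_nonZeroDivisors (maximalIdeal A)
      (mem_nonZeroDivisors_of_ne_zero hx)
    exact (MulEquivClass.map_nonZeroDivisors e) ▸ Submonoid.mem_map_of_mem _ this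
  refine ⟨fun n hn ↦ ?_, fun hM ↦ ?_, ?_⟩
  · rw [← map_intCast φ] at hn ⊢
    exact hφ _ fun h ↦ hn (by rw [h, map_zero])
  · have hmax : maximalIdeal A ≠ ⊥ := fun h0 ↦ by
      have h1 : maximalIdeal (AdicCompletion (maximalIdeal A) A) = ⊥ := by
        rw [AdicCompletion.maximalIdeal_eq_map, h0, Ideal.map_bot]
      have := isField_iff_maximalIdeal_eq.mpr h1
      rw [ringKrullDim_eq_zero_of_isField this] at hdim
      norm_num at hdim
    obtain ⟨x, hxm, hx⟩ := Submodule.exists_mem_ne_zero_of_ne_bot hmax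
    have hxM : φ x ∈ maximalIdeal T := by
      rw [mem_maximalIdeal, mem_nonunits_iff]
      intro hu
      refine (mem_maximalIdeal x).mp hxm ?_
      have : IsUnit (algebraMap A (AdicCompletion (maximalIdeal A) A) x) := by
        simpa [φ] using hu
      exact isUnit_of_map_unit _ _ this
    have : φ x ∈ ⋃ p ∈ associatedPrimes T T, (p : Set T) :=
      Set.mem_biUnion hM hxM
    rw [biUnion_associatedPrimes_eq_compl_nonZeroDivisors] at this
    exact this (hφ x hx)
  · have := IsLocalRing.countable_residueField_of_countable_primeSpectrum hdim
    have h1 : Function.Surjective (ResidueField.map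
      (algebraMap A (AdicCompletion (maximalIdeal A) A))) :=
        (AdicCompletion.residueField_map_bijective A).2
    have h2 := (ResidueField.mapEquiv e).surjective
    exact (h2.comp h1).countable

/-! ### Recognizing `T` as the completion of a subring. -/

section Completion

variable {A : Type*} {T : Type*} [CommRing A] [CommRing T]

/-- The extension of `J` is generated by finitely many images of elements of `J`. The ideal these
elements generate in `A` equals its own contraction, so it contains `J`. -/
theorem IsNoetherianRing.of_comap_map_le [IsNoetherianRing T] (φ : A →+* T)
    (h : ∀ I : Ideal A, I.FG → (I.map φ).comap φ ≤ I) : IsNoetherianRing A := by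
  classical
  refine ⟨fun J ↦ ?_⟩
  obtain ⟨s, hs, hspan⟩ := (Submodule.fg_span_iff_fg_span_finset_subset (φ '' J)).mp
    (IsNoetherian.noetherian (Ideal.map φ J))
  obtain ⟨r, hr, hrs⟩ := Finset.subset_set_image_iff.mp hs
  have hfg : (Ideal.span (r : Set A)).FG := ⟨r, rfl⟩
  have hJ : J ≤ Ideal.span (r : Set A) := fun x hx ↦ by
    refine h _ hfg ?_
    rw [Ideal.mem_comap, Ideal.map_span, ← Finset.coe_image, hrs]
    exact hspan.le (Submodule.subset_span (Set.mem_image_of_mem φ hx))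
  rwa [(Ideal.span_le.mpr hr).antisymm hJ] at hfg

variable [IsLocalRing A] [IsLocalRing T]

/-- The maps `A ⧸ m ^ n → T ⧸ M ^ n` are injective by `h₃` and surjective by successive
approximation from `h₁` and `h₂`. -/
theorem AdicCompletion.nonempty_ringEquiv_of_quotient [IsAdicComplete (maximalIdeal T) T]
    (φ : A →+* T) (h₁ : ∀ t, ∃ a, t - φ a ∈ maximalIdeal T)
    (h₂ : (maximalIdeal A).map φ = maximalIdeal T)
    (h₃ : ∀ n : ℕ, (((maximalIdeal A) ^ n).map φ).comap φ ≤ (maximalIdeal A) ^ n) :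
    Nonempty (AdicCompletion (maximalIdeal A) A ≃+* T) := by
  set m := maximalIdeal A
  set M := maximalIdeal T
  have hpow : ∀ n : ℕ, (m ^ n).map φ = M ^ n := fun n ↦ by rw [Ideal.map_pow, h₂]
  have hle : ∀ n : ℕ, m ^ n ≤ (M ^ n).comap φ := fun n ↦ by
    rw [← hpow]; exact Ideal.le_comap_map
  have hge : ∀ n : ℕ, (M ^ n).comap φ ≤ m ^ n := fun n ↦ by
    rw [← hpow]; exact h₃ n
  have happ : ∀ (n : ℕ) (t : T), ∃ a, t - φ a ∈ M ^ n := fun n ↦ by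
    induction n with
    | zero => exact fun t ↦ ⟨0, by simp⟩
    | succ n ih =>
      intro t
      have key : ∀ z ∈ M ^ n, ∃ a ∈ m ^ n, z - φ a ∈ M ^ (n + 1) := fun z hz ↦ by
        rw [← hpow n] at hz
        refine Submodule.span_induction (p := fun z _ ↦ ∃ a ∈ m ^ n, z - φ a ∈ M ^ (n + 1))
          ?_ ?_ ?_ ?_ hz
        · rintro _ ⟨a, ha, rfl⟩
          exact ⟨a, ha, by simp⟩
        · exact ⟨0, zero_mem _, by simp⟩
        · rintro x y _ _ ⟨a, ha, hxa⟩ ⟨b, hb, hyb⟩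
          refine ⟨a + b, add_mem ha hb, ?_⟩
          convert add_mem hxa hyb using 1
          rw [map_add]; ring
        · rintro c x _ ⟨a, ha, hxa⟩
          obtain ⟨b, hb⟩ := h₁ c
          refine ⟨b * a, Ideal.mul_mem_left _ _ ha, ?_⟩
          have e : c • x - φ (b * a) = c * (x - φ a) + (c - φ b) * φ a := by
            rw [map_mul, smul_eq_mul]; ring
          rw [e]
          refine add_mem (Ideal.mul_mem_left _ _ hxa) ?_
          rw [pow_succ']
          exact Ideal.mul_mem_mul hb (hle n ha)
      obtain ⟨a, ha⟩ := ih t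
      obtain ⟨b, _, hb⟩ := key _ ha
      exact ⟨a + b, by rwa [map_add, ← sub_sub]⟩
  let q : ∀ n : ℕ, A ⧸ m ^ n →+* T ⧸ M ^ n := fun n ↦ Ideal.quotientMap (M ^ n) φ (hle n)
  have hq : ∀ n : ℕ, Function.Injective (q n) := fun n ↦
    Ideal.quotientMap_injective' (hge n)
  let f : ∀ n : ℕ, AdicCompletion m A →+* T ⧸ M ^ n := fun n ↦
    (q n).comp (AdicCompletion.evalₐ m n : AdicCompletion m A →+* A ⧸ m ^ n)
  have hf : ∀ {k n : ℕ} (hkn : k ≤ n), (Ideal.Quotient.factorPow M hkn).comp (f n) = f k := by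
    intro k n hkn
    ext x
    obtain ⟨s, rfl⟩ := AdicCompletion.mk_surjective m A x
    simp only [f, q, RingHom.comp_apply, RingHom.coe_coe, AdicCompletion.evalₐ_mk,
      Ideal.quotientMap_mk]
    have h := congrArg (q k) (AdicCompletion.Ideal.mk_eq_mk m hkn s)
    simpa [q] using h
  let F := IsAdicComplete.liftRingHom M f hf
  have hF : ∀ n x, Ideal.Quotient.mk (M ^ n) (F x) = q n (AdicCompletion.evalₐ m n x) :=
    fun n x ↦ IsAdicComplete.mk_liftRingHom M f hf n x
  refine ⟨RingEquiv.ofBijective F ⟨?_, fun t ↦ ?_⟩⟩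
  · rw [injective_iff_map_eq_zero]
    intro x hx
    refine AdicCompletion.ext_evalₐ fun n ↦ hq n ?_
    rw [← hF, ← hF, hx, _root_.map_zero F]
  · choose a ha using happ
    have hc : ∀ {k n : ℕ}, k ≤ n → a k t ≡ a n t [SMOD (m ^ k • ⊤ : Submodule A A)] := by
      intro k n hkn
      rw [SModEq.sub_mem, smul_eq_mul, Ideal.mul_top]
      refine hge k ?_
      rw [Ideal.mem_comap, map_sub]
      convert sub_mem (Ideal.pow_le_pow_right hkn (ha n t)) (ha k t) using 1
      ring
    let s : AdicCompletion.AdicCauchySequence m A := ⟨fun n ↦ a n t, hc⟩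
    have hs : ∀ n, q n (AdicCompletion.evalₐ m n (AdicCompletion.mk m A s)) =
        Ideal.Quotient.mk (M ^ n) (φ (a n t)) := fun n ↦ by
      rw [AdicCompletion.evalₐ_mk]
      exact Ideal.quotientMap_mk
    refine ⟨AdicCompletion.mk m A s, ?_⟩
    rw [← sub_eq_zero]
    refine IsHausdorff.haus (I := M) inferInstance _ fun n ↦ ?_
    rw [SModEq.zero, smul_eq_mul, Ideal.mul_top, ← Ideal.Quotient.eq_zero_iff_mem, map_sub, hF,
      hs, ← map_sub, Ideal.Quotient.eq_zero_iff_mem,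
      ← neg_mem_iff, neg_sub]
    exact ha n t

end Completion

/-! ### Baire-type avoidance in a complete local ring. -/

section Avoidance

variable {T : Type u} [CommRing T] [IsLocalRing T] [IsNoetherianRing T]

/-- Ideals are closed in the adic topology: `T ⧸ P` is separated by Krull's intersection theorem. -/
theorem IsLocalRing.exists_pow_forall_add_notMem (P : Ideal T) {z : T} (hz : z ∉ P) :
    ∃ k : ℕ, ∀ w ∈ maximalIdeal T ^ k, z + w ∉ P := by
  by_contra! h
  refine hz (Ideal.Quotient.eq_zero_iff_mem.mp ?_)
  refine IsHausdorff.haus (I := maximalIdeal T) (M := T ⧸ P) inferInstance _ fun k ↦ ?_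
  obtain ⟨w, hw, hzw⟩ := h k
  rw [SModEq.zero]
  have : Ideal.Quotient.mk P z = (-w) • (1 : T ⧸ P) := by
    rw [Algebra.smul_def, mul_one, Ideal.Quotient.algebraMap_eq, Ideal.Quotient.eq]
    simpa using hzw
  rw [this]
  exact Submodule.smul_mem_smul (neg_mem hw) trivial

/-- Countable coset avoidance in a complete local ring. -/
theorem IsLocalRing.exists_forall_sub_notMem [IsAdicComplete (maximalIdeal T) T] {ι : Type*}
    [Countable ι] (P : ι → Ideal T) (d : ι → T) (hP : ∀ i (n : ℕ), ¬ maximalIdeal T ^ n ≤ P i) :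
    ∃ y, ∀ i, y - d i ∉ P i := by
  cases isEmpty_or_nonempty ι with
  | inl _ => exact ⟨0, isEmptyElim⟩
  | inr _ =>
  obtain ⟨g, hg⟩ := exists_surjective_nat ι
  -- A pair `(y, k)` encodes the ball `y + M ^ k`. The next ball lies inside it and misses the
  -- `n`-th coset.
  have step : ∀ (n : ℕ) (s : T × ℕ), ∃ s' : T × ℕ, s.2 < s'.2 ∧
      s'.1 - s.1 ∈ maximalIdeal T ^ s.2 ∧
      ∀ w ∈ maximalIdeal T ^ s'.2, s'.1 + w - d (g n) ∉ P (g n) := by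
    rintro n ⟨y, k⟩
    obtain ⟨z, hz, hyz⟩ : ∃ z ∈ maximalIdeal T ^ k, y + z - d (g n) ∉ P (g n) := by
      by_cases h : y - d (g n) ∈ P (g n)
      · obtain ⟨z, hz, hzP⟩ := SetLike.not_le_iff_exists.mp (hP (g n) k)
        refine ⟨z, hz, fun h' ↦ hzP ?_⟩
        convert sub_mem h' h using 1
        ring
      · exact ⟨0, zero_mem _, by simpa using h⟩
    obtain ⟨l, hl⟩ := exists_pow_forall_add_notMem _ hyz
    refine ⟨(y + z, max (k + 1) l), by simp, by simpa using hz, fun w hw ↦ ?_⟩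
    have := hl w (Ideal.pow_le_pow_right (le_max_right _ _) hw)
    rwa [sub_add_eq_add_sub] at this
  choose S hlt hS hS' using step
  let x : ℕ → T × ℕ := fun n ↦ Nat.rec (0, 0) S n
  have hmono : StrictMono fun n ↦ (x n).2 := strictMono_nat_of_lt_succ fun n ↦ hlt n (x n)
  have hsub : ∀ {k n : ℕ}, k ≤ n → (x n).1 - (x k).1 ∈ maximalIdeal T ^ (x k).2 := by
    intro k n hkn
    induction n, hkn using Nat.le_induction with
    | base => simp
    | succ n hkn ih =>
      have h1 := Ideal.pow_le_pow_right (hmono.monotone hkn) (hS n (x n))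
      convert add_mem h1 ih using 1
      simp [x]
  obtain ⟨L, hL⟩ := IsPrecomplete.prec (I := maximalIdeal T) (M := T) inferInstance
    (f := fun n ↦ (x n).1) (fun {k n} hkn ↦ by
      rw [SModEq.sub_mem, smul_eq_mul, Ideal.mul_top, ← neg_mem_iff, neg_sub]
      exact Ideal.pow_le_pow_right (hmono.le_apply) (hsub hkn))
  have hL' : ∀ k, L - (x k).1 ∈ maximalIdeal T ^ (x k).2 := fun k ↦ by
    have h1 := hL (x k).2
    rw [SModEq.sub_mem, smul_eq_mul, Ideal.mul_top] at h1
    convert sub_mem (hsub (hmono.le_apply (x := k))) h1 using 1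
    ring
  refine ⟨L, fun i ↦ ?_⟩
  obtain ⟨n, rfl⟩ := hg i
  have := hS' n (x n) _ (hL' (n + 1))
  convert this using 1
  simp [x]

end Avoidance

/-! ### Enlarging countable regular subrings. -/

/-- A countable subring all of whose nonzero elements are regular in the ambient ring. -/
structure Subring.IsCountableRegular {T : Type u} [CommRing T] (R : Subring T) : Prop where
  countable : Countable R
  regular : ∀ r ∈ R, r ≠ 0 → r ∈ nonZeroDivisors T

theorem Polynomial.countable_of_countable (R : Type*) [Semiring R] [Countable R] :
    Countable (Polynomial R) := by
  rw [← Cardinal.mk_le_aleph0_iff]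
  exact Polynomial.cardinalMk_le_max.trans (max_le (Cardinal.mk_le_aleph0_iff.mpr ‹_›) le_rfl)

namespace Subring.IsCountableRegular

variable {T : Type u} [CommRing T]

theorem range_intCast (h : ∀ n : ℤ, (n : T) ≠ 0 → (n : T) ∈ nonZeroDivisors T) :
    (Int.castRingHom T).range.IsCountableRegular where
  countable := (Int.castRingHom T).rangeRestrict_surjective.countable
  regular := by
    rintro _ ⟨n, rfl⟩ hn
    exact h n hn

theorem iSup_of_monotone {R : ℕ → Subring T} (hR : Monotone R)
    (h : ∀ n, (R n).IsCountableRegular) : (⨆ n, R n).IsCountableRegular where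
  countable := by
    have : ((⨆ n, R n : Subring T) : Set T).Countable := by
      rw [Subring.coe_iSup_of_directed hR.directed_le]
      exact Set.countable_iUnion fun n ↦ Set.countable_coe_iff.mp (h n).countable
    exact this.to_subtype
  regular r hr h0 := by
    obtain ⟨n, hn⟩ := (Subring.mem_iSup_of_directed hR.directed_le).mp hr
    exact (h n).regular r hn h0

theorem exists_ge_mem {R : Subring T} (hR : R.IsCountableRegular) (x : T)
    (hx : ∀ p : Polynomial R, p.eval₂ R.subtype x ≠ 0 →
      p.eval₂ R.subtype x ∈ nonZeroDivisors T) :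
    ∃ S ≥ R, S.IsCountableRegular ∧ x ∈ S := by
  have := hR.countable
  have : Countable (Polynomial R) := Polynomial.countable_of_countable R
  refine ⟨(Polynomial.eval₂RingHom R.subtype x).range, fun r hr ↦ ⟨Polynomial.C ⟨r, hr⟩, by simp⟩,
    ⟨(Polynomial.eval₂RingHom R.subtype x).rangeRestrict_surjective.countable, ?_⟩,
    ⟨Polynomial.X, by simp⟩⟩
  rintro _ ⟨p, rfl⟩ h0
  exact hx p h0

/-- Multiplying a polynomial in `t` by a power of the regular element `a` lands it in `R`, where
nonzero elements are regular. -/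
theorem exists_ge_mem_of_mul_mem {R : Subring T} (hR : R.IsCountableRegular) {a t : T}
    (ha : a ∈ R) (ha0 : a ≠ 0) (hat : a * t ∈ R) :
    ∃ S ≥ R, S.IsCountableRegular ∧ t ∈ S := by
  refine hR.exists_ge_mem t fun p hp ↦ ?_
  obtain ⟨k, hk⟩ : ∃ k : ℕ, a ^ k * p.eval₂ R.subtype t ∈ R := by
    clear hp
    induction p using Polynomial.induction_on' with
    | add p q hp' hq' =>
      obtain ⟨k, hk⟩ := hp'
      obtain ⟨l, hl⟩ := hq'
      refine ⟨k + l, ?_⟩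
      convert add_mem (mul_mem (pow_mem ha l) hk) (mul_mem (pow_mem ha k) hl) using 1
      rw [Polynomial.eval₂_add]; ring
    | monomial n c =>
      refine ⟨n, ?_⟩
      rw [Polynomial.eval₂_monomial]
      convert mul_mem c.2 (pow_mem hat n) using 1
      rw [mul_pow, subtype_apply]; ring
  have hreg := pow_mem (hR.regular a ha ha0) k
  have : a ^ k * p.eval₂ R.subtype t ≠ 0 := fun h ↦
    hp ((mem_nonZeroDivisors_iff_left.mp hreg) _ h)
  exact (mul_mem_nonZeroDivisors.mp (hR.regular _ hk this)).2

theorem exists_ge_forall {ι : Type*} [Countable ι] (Q : ι → Subring T → Prop)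
    (hmono : ∀ i R S, R ≤ S → Q i R → Q i S) {R : Subring T} (hR : R.IsCountableRegular)
    (h : ∀ i, ∀ S ≥ R, S.IsCountableRegular → ∃ S' ≥ S, S'.IsCountableRegular ∧ Q i S') :
    ∃ S ≥ R, S.IsCountableRegular ∧ ∀ i, Q i S := by
  cases isEmpty_or_nonempty ι with
  | inl _ => exact ⟨R, le_rfl, hR, isEmptyElim⟩
  | inr _ =>
  obtain ⟨g, hg⟩ := exists_surjective_nat ι
  let X := {S : Subring T // S ≥ R ∧ S.IsCountableRegular}
  have step : ∀ (n : ℕ) (S : X), ∃ S' : X, S.1 ≤ S'.1 ∧ Q (g n) S'.1 := fun n S ↦ by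
    obtain ⟨S', hS', h1, h2⟩ := h (g n) S.1 S.2.1 S.2.2
    exact ⟨⟨S', S.2.1.trans hS', h1⟩, hS', h2⟩
  choose f hf hQ using step
  let x : ℕ → X := fun n ↦ Nat.rec ⟨R, le_rfl, hR⟩ f n
  have hx : Monotone fun n ↦ (x n).1 := monotone_nat_of_le_succ fun n ↦ hf n (x n)
  refine ⟨⨆ n, (x n).1, le_iSup (fun n ↦ (x n).1) 0, iSup_of_monotone hx fun n ↦ (x n).2.2,
    fun i ↦ ?_⟩
  obtain ⟨n, rfl⟩ := hg i
  exact hmono _ _ _ (le_iSup (fun n ↦ (x n).1) (n + 1)) (hQ n (x n))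

variable [IsLocalRing T] [IsNoetherianRing T] [IsAdicComplete (maximalIdeal T) T]

theorem exists_ge_add_mul_mem (hM : maximalIdeal T ∉ associatedPrimes T T)
    {R : Subring T} (hR : R.IsCountableRegular) (t : T) {b : T} (hb : b ∈ nonZeroDivisors T) :
    ∃ y, ∃ S ≥ R, S.IsCountableRegular ∧ t + b * y ∈ S := by
  have := hR.countable
  have : Countable (Polynomial R) := Polynomial.countable_of_countable R
  have : Finite (associatedPrimes T T) := associatedPrimes.finite T T
  have hprime : ∀ P : associatedPrimes T T, P.1.IsPrime := fun P ↦ P.2.isPrime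
  have hzd : ∀ x : T, x ∉ nonZeroDivisors T ↔ ∃ P : associatedPrimes T T, x ∈ P.1 := fun x ↦ by
    have := Set.ext_iff.mp (biUnion_associatedPrimes_eq_compl_nonZeroDivisors T) x
    simpa using this.symm
  let ψ : ∀ P : associatedPrimes T T, R →+* T ⧸ P.1 :=
    fun P ↦ (Ideal.Quotient.mk P.1).comp R.subtype
  have hψ : ∀ P, Function.Injective (ψ P) := fun P ↦ by
    rw [injective_iff_map_eq_zero]
    intro r hr
    by_contra h0
    exact (hzd r).mpr ⟨P, Ideal.Quotient.eq_zero_iff_mem.mp hr⟩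
      (hR.regular r r.2 fun h ↦ h0 (Subtype.ext h))
  -- The bad residues of `y`: those making `t + b * y` algebraic over `R` modulo `P`. They are
  -- countably many, since `b` is nonzero modulo `P` and `R[X]` is countable.
  let E : ∀ P : associatedPrimes T T, Set (T ⧸ P.1) := fun P ↦
    {z | ∃ p : Polynomial R, p ≠ 0 ∧
      p.eval₂ (ψ P) (Ideal.Quotient.mk P.1 t + Ideal.Quotient.mk P.1 b * z) = 0}
  have hE : ∀ P, (E P).Countable := fun P ↦ by
    have := hprime P
    have hinj : Function.Injective
        fun z ↦ Ideal.Quotient.mk P.1 t + Ideal.Quotient.mk P.1 b * z := by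
      intro z w hzw
      refine mul_left_cancel₀ (fun h ↦ ?_) (add_left_cancel hzw)
      exact (hzd b).mpr ⟨P, Ideal.Quotient.eq_zero_iff_mem.mp h⟩ hb
    have hroot : (⋃ p : {p : Polynomial R // p ≠ 0},
        {z | (p.1.map (ψ P)).IsRoot z}).Countable := by
      refine Set.countable_iUnion fun p ↦ (Polynomial.finite_setOfPred_isRoot ?_).countable
      exact (Polynomial.map_ne_zero_iff (hψ P)).mpr p.2
    refine (hroot.preimage_of_injOn hinj.injOn).mono ?_
    rintro z ⟨p, hp, hz⟩
    refine Set.mem_iUnion.mpr ⟨⟨p, hp⟩, ?_⟩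
    simpa [Polynomial.IsRoot, Polynomial.eval_map] using hz
  have : ∀ P, Countable (E P) := fun P ↦ (hE P).to_subtype
  obtain ⟨y, hy⟩ := exists_forall_sub_notMem
    (fun i : Σ P : associatedPrimes T T, E P ↦ i.1.1) (fun i ↦ Quotient.out i.2.1)
    (fun i n hle ↦ hM (by
      have := hprime i.1
      have h1 := (Ideal.IsPrime.le_of_pow_le hle)
      have h2 := (le_maximalIdeal (hprime i.1).ne_top).antisymm h1
      exact h2 ▸ i.1.2))
  refine ⟨y, hR.exists_ge_mem _ fun p hp ↦ ?_⟩
  by_contra hzero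
  obtain ⟨P, hP⟩ := (hzd _).mp hzero
  have hmem : Ideal.Quotient.mk P.1 y ∈ E P := by
    refine ⟨p, fun h ↦ hp (by rw [h, Polynomial.eval₂_zero]), ?_⟩
    rw [← Ideal.Quotient.eq_zero_iff_mem, Polynomial.hom_eval₂] at hP
    simpa using hP
  refine hy ⟨P, _, hmem⟩ ?_
  rw [← Ideal.Quotient.eq]
  exact (Ideal.Quotient.mk_out _).symm

theorem exists_ge_sub_mem_sq (hM : maximalIdeal T ∉ associatedPrimes T T)
    {R : Subring T} (hR : R.IsCountableRegular) (t : T) :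
    ∃ S ≥ R, S.IsCountableRegular ∧ ∃ r ∈ S, r - t ∈ maximalIdeal T ^ 2 := by
  obtain ⟨b, hbM, hb⟩ : ∃ b ∈ maximalIdeal T, b ∈ nonZeroDivisors T := by
    by_contra! h
    obtain ⟨P, hP, hle⟩ := ((maximalIdeal T).subset_union_prime_finite
      (associatedPrimes.finite T T) (f := id) 0 0 fun _ h _ _ ↦ h.isPrime).1 (by
        simp_rw [id, biUnion_associatedPrimes_eq_compl_nonZeroDivisors]
        exact h)
    exact hM ((hle.antisymm (le_maximalIdeal hP.isPrime.ne_top)) ▸ hP)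
  obtain ⟨y, S, hRS, hS, hy⟩ := hR.exists_ge_add_mul_mem hM t (pow_mem hb 2)
  refine ⟨S, hRS, hS, _, hy, ?_⟩
  rw [add_sub_cancel_left]
  exact Ideal.mul_mem_right _ _ (Ideal.pow_mem_pow hbM 2)

/-- Induction on the generators. In `c = t * a + z` the coefficient `t` may not be adjoinable, but
`t + b * y` is for a nonzero generator `b` in `s`, and the error `y * a * b` is absorbed into `z`.
If no such `b` exists, `c = t * a` and `t` is adjoined as a fraction. -/
theorem exists_ge_eq_sum (hM : maximalIdeal T ∉ associatedPrimes T T) (s : Finset T) :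
    ∀ {R : Subring T}, R.IsCountableRegular → (s : Set T) ⊆ R → ∀ c ∈ R,
    c ∈ Ideal.span (s : Set T) →
    ∃ S ≥ R, S.IsCountableRegular ∧ ∃ f : T → T, (∀ x ∈ s, f x ∈ S) ∧ c = ∑ x ∈ s, f x * x := by
  classical
  induction s using Finset.induction_on with
  | empty =>
    intro R hR _ c _ hc
    exact ⟨R, le_rfl, hR, 0, by simp, by simpa using hc⟩
  | insert a s has ih =>
    intro R hR hsR c hcR hc
    rw [Finset.coe_insert] at hc hsR
    obtain ⟨haR, hsR⟩ := Set.insert_subset_iff.mp hsR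
    obtain ⟨t, z, hz, rfl⟩ := Ideal.mem_span_insert.mp hc
    by_cases hs : ∃ b ∈ s, b ≠ 0
    · obtain ⟨b, hbs, hb0⟩ := hs
      obtain ⟨y, S₁, hRS₁, hS₁, hy⟩ :=
        hR.exists_ge_add_mul_mem hM t (hR.regular b (hsR hbs) hb0)
      obtain ⟨S, hS₁S, hS, f, hf, hsum⟩ := ih hS₁ (hsR.trans hRS₁)
        (t * a + z - (t + b * y) * a) (sub_mem (hRS₁ hcR) (mul_mem hy (hRS₁ haR))) (by
          have : t * a + z - (t + b * y) * a = z - (y * a) * b := by ring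
          rw [this]
          exact sub_mem hz (Ideal.mul_mem_left _ _ (Ideal.subset_span hbs)))
      refine ⟨S, hRS₁.trans hS₁S, hS, Function.update f a (t + b * y), fun x hx ↦ ?_, ?_⟩
      · by_cases hxa : x = a
        · subst hxa
          simpa using hS₁S hy
        · rw [Function.update_of_ne hxa]
          exact hf x (Finset.mem_of_mem_insert_of_ne hx hxa)
      · have hcongr : ∑ x ∈ s, Function.update f a (t + b * y) x * x = ∑ x ∈ s, f x * x :=
          Finset.sum_congr rfl fun x hx ↦ by
            rw [Function.update_of_ne (ne_of_mem_of_not_mem hx has)]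
        rw [Finset.sum_insert has, Function.update_self, hcongr, ← hsum]
        ring
    · push Not at hs
      have hz0 : z = 0 := by
        have : Ideal.span (s : Set T) = ⊥ := Ideal.span_eq_bot.mpr hs
        rwa [this, Ideal.mem_bot] at hz
      subst hz0
      rw [add_zero] at hcR ⊢
      have hsum : ∀ u : T, ∑ x ∈ insert a s, u * x = u * a := fun u ↦ by
        rw [Finset.sum_insert has, Finset.sum_eq_zero (fun x hx ↦ by rw [hs x hx, mul_zero]),
          add_zero]
      by_cases ha0 : a = 0
      · exact ⟨R, le_rfl, hR, 0, fun _ _ ↦ zero_mem R, by simp [ha0]⟩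
      · obtain ⟨S, hRS, hS, ht⟩ := hR.exists_ge_mem_of_mul_mem haR ha0 (mul_comm t a ▸ hcR)
        exact ⟨S, hRS, hS, fun _ ↦ t, fun _ _ ↦ ht, (hsum t).symm⟩

/-- A countable regular subring that is closed under solving linear equations solvable in the
ambient ring, and that approximates countably many prescribed elements. -/
theorem exists_closed (hM : maximalIdeal T ∉ associatedPrimes T T) {R₀ : Subring T}
    (hR₀ : R₀.IsCountableRegular) {D : Set T} (hD : D.Countable) :
    ∃ R : Subring T, R.IsCountableRegular ∧
      (∀ t ∈ D, ∃ r ∈ R, r - t ∈ maximalIdeal T ^ 2) ∧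
      ∀ s : Finset T, (s : Set T) ⊆ R → ∀ c ∈ R, c ∈ Ideal.span (s : Set T) →
        ∃ f : T → T, (∀ x ∈ s, f x ∈ R) ∧ c = ∑ x ∈ s, f x * x := by
  classical
  have := hD.to_subtype
  obtain ⟨R₁, -, hR₁, hDR₁⟩ := exists_ge_forall
    (fun (t : D) (S : Subring T) ↦ ∃ r ∈ S, r - t.1 ∈ maximalIdeal T ^ 2)
    (fun _ _ _ hle ⟨r, hr, h⟩ ↦ ⟨r, hle hr, h⟩) hR₀
    (fun t S _ hS ↦ hS.exists_ge_sub_mem_sq hM t)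
  let X := {S : Subring T // S.IsCountableRegular}
  -- One stage solves every system over `S`, with solutions in `S'`. The union of the stages is
  -- closed because each system involves finitely many elements.
  have step : ∀ S : X, ∃ S' : X, S.1 ≤ S'.1 ∧ ∀ s : Finset T, (s : Set T) ⊆ S.1 → ∀ c ∈ S.1,
      c ∈ Ideal.span (s : Set T) →
        ∃ f : T → T, (∀ x ∈ s, f x ∈ S'.1) ∧ c = ∑ x ∈ s, f x * x := by
    rintro ⟨S, hS⟩
    have := hS.countable
    obtain ⟨S', hSS', hS', h⟩ := exists_ge_forall
      (fun (i : Finset S × S) (S' : Subring T) ↦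
        (i.2 : T) ∈ Ideal.span ((i.1.image Subtype.val : Finset T) : Set T) →
          ∃ f : T → T, (∀ x ∈ i.1.image Subtype.val, f x ∈ S') ∧
            (i.2 : T) = ∑ x ∈ i.1.image Subtype.val, f x * x)
      (fun _ _ _ hle h hi ↦ by
        obtain ⟨f, hf, hsum⟩ := h hi
        exact ⟨f, fun x hx ↦ hle (hf x hx), hsum⟩) hS
      (fun ⟨s, c⟩ S₁ hSS₁ hS₁ ↦ by
        by_cases hc : (c : T) ∈ Ideal.span ((s.image Subtype.val : Finset T) : Set T)
        · obtain ⟨S₂, h1, h2, h3⟩ := exists_ge_eq_sum hM _ hS₁ (by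
            intro x hx
            obtain ⟨y, -, rfl⟩ := Finset.mem_image.mp (Finset.mem_coe.mp hx)
            exact hSS₁ y.2) c (hSS₁ c.2) hc
          exact ⟨S₂, h1, h2, fun _ ↦ h3⟩
        · exact ⟨S₁, le_rfl, hS₁, fun h ↦ absurd h hc⟩)
    refine ⟨⟨S', hS'⟩, hSS', fun s hs c hc hcs ↦ ?_⟩
    obtain ⟨s, rfl⟩ : ∃ s' : Finset S, s'.image Subtype.val = s :=
      ⟨s.preimage Subtype.val Subtype.val_injective.injOn, by
        rw [Finset.image_preimage]
        exact Finset.filter_true_of_mem fun x hx ↦ ⟨⟨x, hs hx⟩, rfl⟩⟩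
    exact h ⟨s, ⟨c, hc⟩⟩ hcs
  choose g hg hsol using step
  let x : ℕ → X := fun n ↦ Nat.rec ⟨R₁, hR₁⟩ (fun _ ↦ g) n
  have hx : Monotone fun n ↦ (x n).1 := monotone_nat_of_le_succ fun n ↦ hg (x n)
  have hle : ∀ n, (x n).1 ≤ ⨆ n, (x n).1 := le_iSup (fun n ↦ (x n).1)
  refine ⟨⨆ n, (x n).1, iSup_of_monotone hx fun n ↦ (x n).2, fun t ht ↦ ?_, fun s hs c hc hcs ↦ ?_⟩
  · obtain ⟨r, hr, h⟩ := hDR₁ ⟨t, ht⟩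
    exact ⟨r, hle 0 hr, h⟩
  · have hfin : ∃ n, (s : Set T) ⊆ (x n).1 := by
      have hcoe := Subring.coe_iSup_of_directed (S := fun n ↦ (x n).1) hx.directed_le
      rw [hcoe] at hs
      exact Directed.exists_mem_subset_of_finset_subset_biUnion
        (f := fun n ↦ ((x n).1 : Set T)) hx.directed_le hs
    obtain ⟨n, hn⟩ := hfin
    obtain ⟨k, hk⟩ := (Subring.mem_iSup_of_directed hx.directed_le).mp hc
    obtain ⟨f, hf, hsum⟩ := hsol (x (max n k)) s (hn.trans (hx (le_max_left n k))) c
      (hx (le_max_right n k) hk) hcs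
    exact ⟨f, fun y hy ↦ hle (max n k + 1) (hf y hy), hsum⟩

end Subring.IsCountableRegular

theorem PrimeSpectrum.countable_of_countable (A : Type*) [CommRing A] [IsNoetherianRing A]
    [Countable A] : Countable (PrimeSpectrum A) := by
  have h : ∀ p : PrimeSpectrum A, ∃ s : Finset A, Ideal.span (s : Set A) = p.asIdeal :=
    fun p ↦ p.asIdeal.fg_of_isNoetherianRing
  choose g hg using h
  exact Function.Injective.countable (f := g) fun p q hpq ↦
    PrimeSpectrum.ext (by rw [← hg p, ← hg q, hpq])

/-! ### The countable domain and the equivalence. -/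

section CountableDomain

variable {T : Type u} [CommRing T] [IsLocalRing T] [IsNoetherianRing T]

/-- Nakayama: elements approximating generators of `M` modulo `M ^ 2` generate `M`. -/
theorem IsLocalRing.map_eq_maximalIdeal_of_forall_generator {A : Type*} [CommRing A] (φ : A →+* T)
    {s : Set T} (hs : Ideal.span s = maximalIdeal T)
    (h : ∀ t ∈ s, ∃ a, φ a - t ∈ maximalIdeal T ^ 2) :
    ((maximalIdeal T).comap φ).map φ = maximalIdeal T := by
  refine le_antisymm Ideal.map_comap_le ?_
  refine Submodule.le_of_le_smul_of_le_jacobson_bot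
    (maximalIdeal T).fg_of_isNoetherianRing (maximalIdeal_le_jacobson ⊥) ?_
  nth_rw 1 [← hs]
  rw [Ideal.span_le]
  intro t ht
  obtain ⟨a, ha⟩ := h t ht
  have htM : t ∈ maximalIdeal T := hs ▸ Ideal.subset_span ht
  have haM : φ a ∈ maximalIdeal T := by
    have := add_mem (Ideal.pow_le_self two_ne_zero ha) htM
    rwa [sub_add_cancel] at this
  have e : t = φ a - (φ a - t) := by ring
  rw [e]
  refine sub_mem (Ideal.mem_sup_left (Ideal.mem_map_of_mem φ haM)) (Ideal.mem_sup_right ?_)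
  rwa [smul_eq_mul, ← sq]

/-- Sufficient conditions for a complete local ring to be the completion of a countable local
domain. -/
theorem exists_countable_domain_completion_equiv [IsAdicComplete (maximalIdeal T) T]
    (hint : ∀ n : ℤ, (n : T) ≠ 0 → (n : T) ∈ nonZeroDivisors T)
    (hM : maximalIdeal T ∉ associatedPrimes T T) [Countable (T ⧸ maximalIdeal T)] :
    ∃ (A : Type u) (_ : CommRing A) (_ : IsDomain A) (_ : IsLocalRing A) (_ : IsNoetherianRing A),
      Nonempty (AdicCompletion (maximalIdeal A) A ≃+* T) ∧ Countable A := by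
  obtain ⟨s, hs⟩ := (maximalIdeal T).fg_of_isNoetherianRing
  obtain ⟨R, hR, hD, hsol⟩ := Subring.IsCountableRegular.exists_closed hM
    (Subring.IsCountableRegular.range_intCast hint)
    ((Set.countable_range (Quotient.out : T ⧸ maximalIdeal T → T)).union s.countable_toSet)
  have hres : ∀ t, ∃ a : R, t - R.subtype a ∈ maximalIdeal T := fun t ↦ by
    obtain ⟨r, hr, h⟩ := hD _ (Or.inl ⟨Ideal.Quotient.mk _ t, rfl⟩)
    refine ⟨⟨r, hr⟩, ?_⟩
    rw [← Ideal.Quotient.eq, ← Ideal.Quotient.mk_out (Ideal.Quotient.mk _ t), eq_comm,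
      Ideal.Quotient.eq]
    exact Ideal.pow_le_self two_ne_zero h
  have hmap := map_eq_maximalIdeal_of_forall_generator R.subtype hs fun t ht ↦ by
    obtain ⟨r, hr, h⟩ := hD t (Or.inr ht)
    exact ⟨⟨r, hr⟩, h⟩
  have hcomap : ∀ I : Ideal R, I.FG → (I.map R.subtype).comap R.subtype ≤ I := by
    classical
    rintro _ ⟨g, rfl⟩ c hc
    rw [Ideal.mem_comap, Ideal.map_span, ← Finset.coe_image] at hc
    obtain ⟨f, hf, hsum⟩ := hsol (g.image R.subtype) (by
      rw [Finset.coe_image]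
      rintro _ ⟨y, -, rfl⟩
      exact y.2) c c.2 hc
    rw [Finset.sum_image (R.subtype_injective.injOn)] at hsum
    have : c = ∑ x ∈ g.attach, (⟨f x.1, hf _ (Finset.mem_image_of_mem _ x.2)⟩ : R) * x.1 := by
      apply Subtype.ext
      rw [hsum, ← Finset.sum_attach]
      simp
    rw [this]
    exact sum_mem fun x _ ↦ Ideal.mul_mem_left _ _ (Ideal.subset_span x.2)
  have hcountable := hR.countable
  have hdomain : IsDomain R := by
    have : NoZeroDivisors R := ⟨fun {a b} hab ↦ by
      by_contra! h
      refine h.2 (Subtype.ext ?_)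
      refine (mem_nonZeroDivisors_iff_left.mp (hR.regular a a.2 fun h' ↦ h.1 (Subtype.ext h'))) _ ?_
      exact congrArg Subtype.val hab⟩
    exact NoZeroDivisors.to_isDomain R
  -- If `a` is a unit of `T`, then `aR = aT ∩ R = R`.
  have hlocalHom : IsLocalHom R.subtype := ⟨fun a ha ↦ by
    rw [← Ideal.span_singleton_eq_top, Ideal.eq_top_iff_one]
    refine hcomap _ ⟨{a}, by simp⟩ ?_
    rw [Ideal.map_span, Set.image_singleton, Ideal.span_singleton_eq_top.mpr ha]
    exact Submodule.mem_top⟩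
  have hlocal : IsLocalRing R := RingHom.domain_isLocalRing R.subtype
  have hnoeth : IsNoetherianRing R := .of_comap_map_le R.subtype hcomap
  have hmax : (maximalIdeal T).comap R.subtype = maximalIdeal R := maximalIdeal_comap R.subtype
  exact ⟨R, inferInstance, hdomain, hlocal, hnoeth,
    AdicCompletion.nonempty_ringEquiv_of_quotient R.subtype hres (hmax ▸ hmap)
      fun n ↦ hcomap _ (Ideal.fg_of_isNoetherianRing _), hcountable⟩

end CountableDomain

theorem theorem3p7 (T : Type u) [CommRing T] [IsLocalRing T] [IsNoetherianRing T]
    [IsAdicComplete (IsLocalRing.maximalIdeal T) T] (hdim : 2 ≤ ringKrullDim T) :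
    (∃ (A : Type u) (_ : CommRing A) (_ : IsDomain A) (_ : IsLocalRing A)
        (_ : IsNoetherianRing A),
        Nonempty (AdicCompletion (IsLocalRing.maximalIdeal A) A ≃+* T) ∧
        Countable (PrimeSpectrum A)) ↔
      (∀ n : ℤ, (n : T) ≠ 0 → (n : T) ∈ nonZeroDivisors T) ∧
      IsLocalRing.maximalIdeal T ∉ associatedPrimes T T ∧
      Countable (T ⧸ IsLocalRing.maximalIdeal T) := by
  constructor
  · rintro ⟨A, _, _, _, _, ⟨e⟩, _⟩
    exact necessary_of_completion_equiv hdim e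
  · rintro ⟨hint, hM, _⟩
    obtain ⟨A, _, _, _, _, he, _⟩ := exists_countable_domain_completion_equiv hint hM
    exact ⟨A, inferInstance, inferInstance, inferInstance, inferInstance, he,
      PrimeSpectrum.countable_of_countable A⟩
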